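/- A \emph{unary monoid} is a monoid $M$ with a unary operation $m\mapsto m^+$; morphisms of unary monoids preserve product, identity and $^+$. It is \emph{left adequate} if it satisfies \[x^+x= x,\quad (x^+y^+)^+ = x^+y^+ = y^+x^+,\quad (xy)^+ = (xy^+)^+,\quad x^2=x\Rightarrow x=x^+,\quad xz=yz\Rightarrow xz^+=yz^+.\] For a set $X$, let $\mathrm{F}_u(X)$ be the free unary monoid on $X$ and $\mathrm{FLAd}(X)$ the free left adequate monoid on $X$. A unary monoid $M$ satisfies the (enriched) identity $u\approx v$, where $u,v\in \mathrm{F}_u(\Sigma)$ for a set $\Sigma$, if $\phi(u)=\phi(v)$ for every unary monoid morphism $\phi\colon \mathrm{F}_u(\Sigma)\to M$. Let $a\neq b$ be letters, and let $X$ be a set with $|X|\ge 2$. (1) If $X$ is finite or countably infinite, then $\mathrm{FLAd}(X)$ embeds as a unary monoid into $\mathrm{FLAd}(\{a,b\})$; indeed, for any indexing $X=\{x_i : i\in I\}$ of the elements of $X$ by distinct non-negative integers ($I\subseteq\{0,1,2,\dots\}$), the map $x_i\mapsto ba^ib$ extends to an injective unary monoid morphism $\mathrm{FLAd}(X)\to\mathrm{FLAd}(\{a,b\})$.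 (2) For $X$ of any cardinality at least $2$, $\mathrm{FLAd}(X)$ and $\mathrm{FLAd}(\{a,b\})$ satisfy the same enriched identities (over every set $\Sigma$). (3) For $X$ of any cardinality at least $2$, every set $\Sigma$ and all $u,v\in\mathrm{F}_u(\Sigma)$, the identity $u\approx v$ is satisfied by $\mathrm{FLAd}(X)$ if and only if $u$ and $v$ represent the same element of $\mathrm{FLAd}(\Sigma)$, that is, have the same image under the morphism $\mathrm{F}_u(\Sigma)\to\mathrm{FLAd}(\Sigma)$ that extends the identity on $\Sigma$. -/

import Mathlib

/-- A unary monoid: an algebra of signature `(2,1,0)` whose `(2,0)`-reduct is a monoid.  No law is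
imposed on the unary operation `plus`, written `m ↦ m⁺` on paper. -/
class UnaryMonoid (M : Type*) extends Monoid M where
  plus : M → M

/-- Morphisms of unary monoids: monoid homomorphisms that commute with `plus`. -/
structure UnaryMonoidHom (M N : Type*) [UnaryMonoid M] [UnaryMonoid N] extends M →* N where
  map_plus' : ∀ x : M, toFun (UnaryMonoid.plus x) = UnaryMonoid.plus (toFun x)

namespace UnaryMonoidHom

variable {M N : Type*} [UnaryMonoid M] [UnaryMonoid N]

instance : FunLike (UnaryMonoidHom M N) M N where
  coe φ := φ.toFun
  coe_injective := by
    rintro ⟨φ, hφ⟩ ⟨ψ, hψ⟩ h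
    have : φ = ψ := MonoidHom.ext (fun x => congrFun h x)
    subst this
    rfl

instance : MonoidHomClass (UnaryMonoidHom M N) M N where
  map_mul φ := φ.map_mul'
  map_one φ := φ.map_one'

theorem map_plus (φ : UnaryMonoidHom M N) (x : M) :
    φ (UnaryMonoid.plus x) = UnaryMonoid.plus (φ x) :=
  φ.map_plus' x

end UnaryMonoidHom

/-- A unary monoid is left adequate if it satisfies the defining (quasi-)identities. -/
class IsLeftAdequate (M : Type*) [UnaryMonoid M] : Prop where
  plus_mul_self : ∀ x : M, UnaryMonoid.plus x * x = x
  plus_plus_mul_plus : ∀ x y : M,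
    UnaryMonoid.plus (UnaryMonoid.plus x * UnaryMonoid.plus y) =
      UnaryMonoid.plus x * UnaryMonoid.plus y
  plus_mul_plus_comm : ∀ x y : M,
    UnaryMonoid.plus x * UnaryMonoid.plus y = UnaryMonoid.plus y * UnaryMonoid.plus x
  plus_mul : ∀ x y : M, UnaryMonoid.plus (x * y) = UnaryMonoid.plus (x * UnaryMonoid.plus y)
  eq_plus_of_idem : ∀ x : M, x * x = x → x = UnaryMonoid.plus x
  mul_plus_of_mul_eq : ∀ x y z : M, x * z = y * z →
    x * UnaryMonoid.plus z = y * UnaryMonoid.plus z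

/-- Formal terms in the signature `(2,1,0)` over the set of variables `X`. -/
inductive UnaryTerm (X : Type*) where
  | var : X → UnaryTerm X
  | one : UnaryTerm X
  | mul : UnaryTerm X → UnaryTerm X → UnaryTerm X
  | plus : UnaryTerm X → UnaryTerm X

/-- The least congruence on terms (for all three operations) containing the monoid laws. -/
inductive UnaryTerm.MonoidRel {X : Type*} : UnaryTerm X → UnaryTerm X → Prop where
  | refl (s) : MonoidRel s s
  | symm {s t} : MonoidRel s t → MonoidRel t s
  | trans {s t r} : MonoidRel s t → MonoidRel t r → MonoidRel s r
  | mul {s s' t t'} : MonoidRel s s' → MonoidRel t t' → MonoidRel (.mul s t) (.mul s' t')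
  | plus {s s'} : MonoidRel s s' → MonoidRel (.plus s) (.plus s')
  | assoc (s t r) : MonoidRel (.mul (.mul s t) r) (.mul s (.mul t r))
  | one_mul (s) : MonoidRel (.mul .one s) s
  | mul_one (s) : MonoidRel (.mul s .one) s

def UnaryTerm.monoidSetoid (X : Type*) : Setoid (UnaryTerm X) :=
  ⟨UnaryTerm.MonoidRel, .refl, .symm, .trans⟩

/-- The free unary monoid `F_u(X)` on `X`. -/
def FreeUnaryMonoid (X : Type*) : Type _ := Quotient (UnaryTerm.monoidSetoid X)

namespace FreeUnaryMonoid

variable {X : Type*}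

instance : UnaryMonoid (FreeUnaryMonoid X) where
  mul := Quotient.map₂ UnaryTerm.mul (fun _ _ h _ _ h' => UnaryTerm.MonoidRel.mul h h')
  one := Quotient.mk _ UnaryTerm.one
  plus := Quotient.map UnaryTerm.plus (fun _ _ h => UnaryTerm.MonoidRel.plus h)
  mul_assoc := by
    rintro ⟨a⟩ ⟨b⟩ ⟨c⟩
    exact Quotient.sound (UnaryTerm.MonoidRel.assoc a b c)
  one_mul := by
    rintro ⟨a⟩
    exact Quotient.sound (UnaryTerm.MonoidRel.one_mul a)
  mul_one := by
    rintro ⟨a⟩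
    exact Quotient.sound (UnaryTerm.MonoidRel.mul_one a)

/-- The generator of `F_u(X)` given by `x : X`. -/
def of (x : X) : FreeUnaryMonoid X := Quotient.mk _ (UnaryTerm.var x)

theorem induction {p : FreeUnaryMonoid X → Prop} (var : ∀ x, p (of x)) (one : p 1)
    (mul : ∀ u v, p u → p v → p (u * v)) (plus : ∀ u, p u → p (UnaryMonoid.plus u)) :
    ∀ u, p u := by
  rintro ⟨t⟩
  induction t with
  | var x => exact var x
  | one => exact one
  | mul s t hs ht => exact mul _ _ hs ht
  | plus s hs => exact plus _ hs

/-- Evaluation of a term under an assignment of its variables. -/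
def interp {M : Type*} [UnaryMonoid M] (f : X → M) : UnaryTerm X → M
  | .var x => f x
  | .one => 1
  | .mul s t => interp f s * interp f t
  | .plus s => UnaryMonoid.plus (interp f s)

theorem interp_eq {M : Type*} [UnaryMonoid M] (f : X → M) {s t : UnaryTerm X}
    (h : UnaryTerm.MonoidRel s t) : interp f s = interp f t := by
  induction h with
  | refl s => rfl
  | symm _ ih => exact ih.symm
  | trans _ _ ih ih' => exact ih.trans ih'
  | mul _ _ ih ih' => simp only [interp, ih, ih']
  | plus _ ih => simp only [interp, ih]
  | assoc s t r => exact mul_assoc _ _ _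
  | one_mul s => exact one_mul _
  | mul_one s => exact mul_one _

/-- The morphism from `F_u(X)` that extends a map from `X` to a unary monoid. -/
def lift {M : Type*} [UnaryMonoid M] (f : X → M) : UnaryMonoidHom (FreeUnaryMonoid X) M where
  toFun := Quotient.lift (interp f) (fun _ _ h => interp_eq f h)
  map_one' := rfl
  map_mul' := by rintro ⟨s⟩ ⟨t⟩; rfl
  map_plus' := by rintro ⟨s⟩; rfl

/-- `F_u(X)` is freely generated by `X` in the class of all unary monoids. -/
theorem existsUnique_lift {M : Type*} [UnaryMonoid M] (f : X → M) :
    ∃! φ : UnaryMonoidHom (FreeUnaryMonoid X) M, ∀ x, φ (of x) = f x := by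
  refine ⟨lift f, fun x => rfl, fun ψ hψ => DFunLike.ext _ _ (fun u => ?_)⟩
  induction u using induction with
  | var x => exact hψ x
  | one => rw [map_one, map_one]
  | mul u v hu hv => rw [map_mul, map_mul, hu, hv]
  | plus u hu => rw [UnaryMonoidHom.map_plus, UnaryMonoidHom.map_plus, hu]

/-- The least congruence on `F_u(X)` (for product and `plus`) that is closed under the
(quasi-)identities of left adequate monoids. -/
inductive LeftAdequateRel : FreeUnaryMonoid X → FreeUnaryMonoid X → Prop where
  | refl (x) : LeftAdequateRel x x
  | symm {x y} : LeftAdequateRel x y → LeftAdequateRel y x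
  | trans {x y z} : LeftAdequateRel x y → LeftAdequateRel y z → LeftAdequateRel x z
  | mul {x x' y y'} : LeftAdequateRel x x' → LeftAdequateRel y y' →
      LeftAdequateRel (x * y) (x' * y')
  | plus {x x'} : LeftAdequateRel x x' →
      LeftAdequateRel (UnaryMonoid.plus x) (UnaryMonoid.plus x')
  | plus_mul_self (x) : LeftAdequateRel (UnaryMonoid.plus x * x) x
  | plus_plus_mul_plus (x y) :
      LeftAdequateRel (UnaryMonoid.plus (UnaryMonoid.plus x * UnaryMonoid.plus y))
        (UnaryMonoid.plus x * UnaryMonoid.plus y)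
  | plus_mul_plus_comm (x y) :
      LeftAdequateRel (UnaryMonoid.plus x * UnaryMonoid.plus y)
        (UnaryMonoid.plus y * UnaryMonoid.plus x)
  | plus_mul (x y) :
      LeftAdequateRel (UnaryMonoid.plus (x * y)) (UnaryMonoid.plus (x * UnaryMonoid.plus y))
  | eq_plus_of_idem {x} : LeftAdequateRel (x * x) x → LeftAdequateRel x (UnaryMonoid.plus x)
  | mul_plus_of_mul_eq {x y z} : LeftAdequateRel (x * z) (y * z) →
      LeftAdequateRel (x * UnaryMonoid.plus z) (y * UnaryMonoid.plus z)

def leftAdequateSetoid (X : Type*) : Setoid (FreeUnaryMonoid X) :=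
  ⟨LeftAdequateRel, .refl, .symm, .trans⟩

end FreeUnaryMonoid

/-- The free left adequate monoid `FLAd(X)` on `X`, in signature `(2,1,0)`. -/
def FLAd (X : Type*) : Type _ := Quotient (FreeUnaryMonoid.leftAdequateSetoid X)

namespace FLAd

variable {X : Type*}

instance : UnaryMonoid (FLAd X) where
  mul := Quotient.map₂ (· * ·) (fun _ _ h _ _ h' => FreeUnaryMonoid.LeftAdequateRel.mul h h')
  one := Quotient.mk _ 1
  plus := Quotient.map UnaryMonoid.plus (fun _ _ h => FreeUnaryMonoid.LeftAdequateRel.plus h)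
  mul_assoc := by
    rintro ⟨a⟩ ⟨b⟩ ⟨c⟩
    exact congrArg (Quotient.mk _) (mul_assoc a b c)
  one_mul := by
    rintro ⟨a⟩
    exact congrArg (Quotient.mk _) (one_mul a)
  mul_one := by
    rintro ⟨a⟩
    exact congrArg (Quotient.mk _) (mul_one a)

instance : IsLeftAdequate (FLAd X) where
  plus_mul_self := by
    rintro ⟨a⟩
    exact Quotient.sound (.plus_mul_self a)
  plus_plus_mul_plus := by
    rintro ⟨a⟩ ⟨b⟩
    exact Quotient.sound (.plus_plus_mul_plus a b)
  plus_mul_plus_comm := by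
    rintro ⟨a⟩ ⟨b⟩
    exact Quotient.sound (.plus_mul_plus_comm a b)
  plus_mul := by
    rintro ⟨a⟩ ⟨b⟩
    exact Quotient.sound (.plus_mul a b)
  eq_plus_of_idem := by
    rintro ⟨a⟩ h
    exact Quotient.sound (.eq_plus_of_idem (Quotient.exact h))
  mul_plus_of_mul_eq := by
    rintro ⟨a⟩ ⟨b⟩ ⟨c⟩ h
    exact Quotient.sound (.mul_plus_of_mul_eq (Quotient.exact h))

/-- The free generator of `FLAd(X)` given by `x : X`. -/
def of (x : X) : FLAd X := Quotient.mk _ (FreeUnaryMonoid.of x)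

/-- The canonical morphism `F_u(X) → FLAd(X)`, which extends the identity on `X` and sends a word
to the element of `FLAd(X)` that it represents. -/
def proj (X : Type*) : UnaryMonoidHom (FreeUnaryMonoid X) (FLAd X) := FreeUnaryMonoid.lift of

theorem proj_eq_mk (u : FreeUnaryMonoid X) : proj X u = Quotient.mk _ u := by
  induction u using FreeUnaryMonoid.induction with
  | var x => rfl
  | one => rfl
  | mul u v hu hv => rw [map_mul, hu, hv]; rfl
  | plus u hu => rw [UnaryMonoidHom.map_plus, hu]; rfl

theorem map_eq_of_rel {M : Type*} [UnaryMonoid M] [IsLeftAdequate M]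
    (φ : UnaryMonoidHom (FreeUnaryMonoid X) M) {u v : FreeUnaryMonoid X}
    (h : FreeUnaryMonoid.LeftAdequateRel u v) : φ u = φ v := by
  induction h with
  | refl x => rfl
  | symm _ ih => exact ih.symm
  | trans _ _ ih ih' => exact ih.trans ih'
  | mul _ _ ih ih' => rw [map_mul, map_mul, ih, ih']
  | plus _ ih => rw [UnaryMonoidHom.map_plus, UnaryMonoidHom.map_plus, ih]
  | plus_mul_self x =>
    rw [map_mul, UnaryMonoidHom.map_plus, IsLeftAdequate.plus_mul_self]
  | plus_plus_mul_plus x y =>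
    simp only [map_mul, UnaryMonoidHom.map_plus, IsLeftAdequate.plus_plus_mul_plus]
  | plus_mul_plus_comm x y =>
    simp only [map_mul, UnaryMonoidHom.map_plus]
    exact IsLeftAdequate.plus_mul_plus_comm _ _
  | plus_mul x y =>
    simp only [map_mul, UnaryMonoidHom.map_plus]
    exact IsLeftAdequate.plus_mul _ _
  | eq_plus_of_idem _ ih =>
    rw [UnaryMonoidHom.map_plus]
    rw [map_mul] at ih
    exact IsLeftAdequate.eq_plus_of_idem _ ih
  | mul_plus_of_mul_eq _ ih =>
    rw [map_mul, map_mul, UnaryMonoidHom.map_plus]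
    rw [map_mul, map_mul] at ih
    exact IsLeftAdequate.mul_plus_of_mul_eq _ _ _ ih

/-- `FLAd(X)` is freely generated by `X` in the class of left adequate monoids. -/
theorem existsUnique_lift {M : Type*} [UnaryMonoid M] [IsLeftAdequate M] (f : X → M) :
    ∃! φ : UnaryMonoidHom (FLAd X) M, ∀ x, φ (of x) = f x := by
  refine ⟨{ toFun := Quotient.lift (FreeUnaryMonoid.lift f) (fun _ _ h => map_eq_of_rel _ h)
            map_one' := rfl
            map_mul' := by rintro ⟨u⟩ ⟨v⟩; exact map_mul (FreeUnaryMonoid.lift f) u v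
            map_plus' := by rintro ⟨u⟩; exact (FreeUnaryMonoid.lift f).map_plus u },
    fun x => rfl, fun ψ hψ => DFunLike.ext _ _ ?_⟩
  rintro ⟨u⟩
  change ψ (Quotient.mk _ u) = FreeUnaryMonoid.lift f u
  rw [← proj_eq_mk]
  induction u using FreeUnaryMonoid.induction with
  | var x => exact hψ x
  | one => simp only [map_one]
  | mul u v hu hv => simp only [map_mul, hu, hv]
  | plus u hu => simp only [UnaryMonoidHom.map_plus, hu]

end FLAd

/-- The unary monoid `M` satisfies the (enriched) identity `u ≈ v` over the alphabet `S`. -/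
def SatisfiesIdentity (M : Type*) [UnaryMonoid M] {S : Type*} (u v : FreeUnaryMonoid S) : Prop :=
  ∀ φ : UnaryMonoidHom (FreeUnaryMonoid S) M, φ u = φ v

/-- The alphabet `{a, b}` of two distinct letters. -/
inductive TwoLetters where
  | a : TwoLetters
  | b : TwoLetters

/-! The core is a solution of the word problem for `FLAd X`. A word is read as a finite rooted tree
with edge labels in `X` and a distinguished trunk: product glues the second tree to the end of the
first trunk, and plus shrinks the trunk to the root. Two words are equal in `FLAd X` exactly when
there are label-preserving, trunk-onto-trunk morphisms both ways between their trees (`Le` in both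
directions). Necessity is `le_of_leftAdequateRel`: every defining rule preserves mutual `Le`,
although trees satisfy the laws only up to this relation. Sufficiency is `val_eq_of_le`: in any left
adequate monoid a rooted tree has an idempotent value, a morphism of rooted trees is a comparison in
the semilattice of such values, and so mutually comparable trees have equal values. The substitution
of `b aⁱ b` for letters replaces each edge by a path. A morphism between encoded trees must follow
such paths from one original vertex to another, so it decodes (`le_of_enc_le`), which makes `encode`
injective. An identity involves finitely many letters; hence a failure in `FLAd S` passes to `FLAd
TwoLetters`, which sits inside `FLAd X`. -/

/-! ### Morphisms -/

namespace UnaryMonoidHom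

/-- Composition of morphisms of unary monoids. -/
def comp {M N P : Type*} [UnaryMonoid M] [UnaryMonoid N] [UnaryMonoid P]
    (ψ : UnaryMonoidHom N P) (φ : UnaryMonoidHom M N) : UnaryMonoidHom M P where
  toMonoidHom := ψ.toMonoidHom.comp φ.toMonoidHom
  map_plus' x := (congrArg ψ (φ.map_plus x)).trans (ψ.map_plus (φ x))

@[simp] theorem comp_apply {M N P : Type*} [UnaryMonoid M] [UnaryMonoid N] [UnaryMonoid P]
    (ψ : UnaryMonoidHom N P) (φ : UnaryMonoidHom M N) (x : M) : ψ.comp φ x = ψ (φ x) := rfl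

/-- The identity morphism. -/
def id (M : Type*) [UnaryMonoid M] : UnaryMonoidHom M M where
  toMonoidHom := MonoidHom.id M
  map_plus' _ := rfl

@[simp] theorem id_apply {M : Type*} [UnaryMonoid M] (x : M) : UnaryMonoidHom.id M x = x := rfl

end UnaryMonoidHom

namespace FreeUnaryMonoid

@[simp] theorem lift_of {X M : Type*} [UnaryMonoid M] (f : X → M) (x : X) :
    lift f (of x) = f x := rfl

theorem hom_ext {X M : Type*} [UnaryMonoid M] {φ ψ : UnaryMonoidHom (FreeUnaryMonoid X) M}
    (h : ∀ x, φ (of x) = ψ (of x)) : φ = ψ :=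
  (existsUnique_lift fun x => ψ (of x)).unique h fun _ => rfl

/-- Every element of `F_u(S)` involves only finitely many letters. -/
theorem exists_finset_forall_mem_range {S : Type*} (u : FreeUnaryMonoid S) :
    ∃ F : Finset S, ∀ G : Finset S, F ⊆ G →
      ∃ u₀ : FreeUnaryMonoid G, lift (fun s : G => of (s : S)) u₀ = u := by
  classical
  induction u using FreeUnaryMonoid.induction with
  | var x => exact ⟨{x}, fun G hG => ⟨of ⟨x, hG (Finset.mem_singleton_self x)⟩, rfl⟩⟩
  | one => exact ⟨∅, fun G _ => ⟨1, map_one _⟩⟩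
  | mul u v hu hv =>
    obtain ⟨F, hF⟩ := hu
    obtain ⟨F', hF'⟩ := hv
    refine ⟨F ∪ F', fun G hG => ?_⟩
    obtain ⟨u₀, rfl⟩ := hF G (Finset.union_subset_left hG)
    obtain ⟨v₀, rfl⟩ := hF' G (Finset.union_subset_right hG)
    exact ⟨u₀ * v₀, map_mul _ _ _⟩
  | plus u hu =>
    obtain ⟨F, hF⟩ := hu
    refine ⟨F, fun G hG => ?_⟩
    obtain ⟨u₀, rfl⟩ := hF G hG
    exact ⟨UnaryMonoid.plus u₀, UnaryMonoidHom.map_plus _ _⟩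

end FreeUnaryMonoid

namespace FLAd

/-- The morphism from `FLAd(X)` that extends a map from `X` to a left adequate monoid. -/
noncomputable def lift {X M : Type*} [UnaryMonoid M] [IsLeftAdequate M] (f : X → M) :
    UnaryMonoidHom (FLAd X) M := (existsUnique_lift f).choose

@[simp] theorem lift_of {X M : Type*} [UnaryMonoid M] [IsLeftAdequate M] (f : X → M) (x : X) :
    lift f (of x) = f x := (existsUnique_lift f).choose_spec.1 x

theorem hom_ext {X M : Type*} [UnaryMonoid M] [IsLeftAdequate M] {φ ψ : UnaryMonoidHom (FLAd X) M}
    (h : ∀ x, φ (of x) = ψ (of x)) : φ = ψ :=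
  (existsUnique_lift fun x => ψ (of x)).unique h fun _ => rfl

@[simp] theorem proj_of {X : Type*} (x : X) : proj X (FreeUnaryMonoid.of x) = of x := rfl

theorem proj_surjective (X : Type*) : Function.Surjective (proj X) := by
  rintro ⟨u⟩
  exact ⟨u, proj_eq_mk u⟩

theorem proj_eq_proj_iff {X : Type*} {u v : FreeUnaryMonoid X} :
    proj X u = proj X v ↔ FreeUnaryMonoid.LeftAdequateRel u v := by
  rw [proj_eq_mk, proj_eq_mk]
  exact ⟨fun h => Quotient.exact h, fun h => Quotient.sound h⟩

theorem hom_eq_of_proj_eq {X M : Type*} [UnaryMonoid M] [IsLeftAdequate M]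
    (φ : UnaryMonoidHom (FreeUnaryMonoid X) M) {u v : FreeUnaryMonoid X}
    (h : proj X u = proj X v) : φ u = φ v :=
  map_eq_of_rel φ (proj_eq_proj_iff.1 h)

/-- An injection of alphabets with a left inverse induces an embedding. -/
theorem lift_of_comp_injective {X Y : Type*} {f : X → Y} {g : Y → X}
    (h : Function.LeftInverse g f) : Function.Injective (lift fun x => of (f x)) := by
  have key : (lift fun y => of (g y)).comp (lift fun x => of (f x)) = UnaryMonoidHom.id (FLAd X) :=
    hom_ext fun x => by simp [h x]
  exact Function.LeftInverse.injective (g := lift fun y => of (g y)) fun m => by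
    simpa using DFunLike.congr_fun key m

end FLAd

/-! ### Rooted trees and simulation -/

/-- Finite rooted edge-labelled trees: `cons x c r` has a branch labelled `x` from the root to the
tree `c`, besides the branches of `r`. -/
inductive LabelledTree (X : Type*) where
  | leaf : LabelledTree X
  | cons : X → LabelledTree X → LabelledTree X → LabelledTree X

namespace LabelledTree

variable {X : Type*}

/-- Gluing two trees at their roots. -/
def append : LabelledTree X → LabelledTree X → LabelledTree X
  | leaf, t => t
  | cons x c r, t => cons x c (append r t)

instance : Append (LabelledTree X) := ⟨append⟩

@[simp] theorem leaf_append (t : LabelledTree X) : leaf ++ t = t := rfl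

@[simp] theorem cons_append (x : X) (c r t : LabelledTree X) :
    cons x c r ++ t = cons x c (r ++ t) := rfl

@[simp] theorem append_leaf (t : LabelledTree X) : t ++ leaf = t := by
  induction t with
  | leaf => rfl
  | cons x c r _ ih => rw [cons_append, ih]

theorem append_assoc (t s r : LabelledTree X) : t ++ s ++ r = t ++ (s ++ r) := by
  induction t with
  | leaf => rfl
  | cons x c q _ ih => rw [cons_append, cons_append, ih, cons_append]

/-- `t.HasBranch x c`: the root of `t` has an edge labelled `x` to a copy of `c`. -/
def HasBranch : LabelledTree X → X → LabelledTree X → Prop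
  | leaf, _, _ => False
  | cons y d r, x, c => (x = y ∧ c = d) ∨ HasBranch r x c

@[simp] theorem not_hasBranch_leaf (x : X) (c : LabelledTree X) : ¬ HasBranch leaf x c := id

@[simp] theorem hasBranch_cons {x y : X} {c d r : LabelledTree X} :
    HasBranch (cons y d r) x c ↔ (x = y ∧ c = d) ∨ HasBranch r x c := Iff.rfl

@[simp] theorem hasBranch_append {t s c : LabelledTree X} {x : X} :
    HasBranch (t ++ s) x c ↔ HasBranch t x c ∨ HasBranch s x c := by
  induction t with
  | leaf => simp
  | cons y d r _ ih => simp [ih, or_assoc]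

/-- The existence of a root-preserving morphism of labelled trees. -/
def Sim : LabelledTree X → LabelledTree X → Prop
  | leaf, _ => True
  | cons x c r, t => (∃ d, HasBranch t x d ∧ Sim c d) ∧ Sim r t

@[simp] theorem leaf_sim (t : LabelledTree X) : Sim leaf t := trivial

@[simp] theorem cons_sim {x : X} {c r t : LabelledTree X} :
    Sim (cons x c r) t ↔ (∃ d, HasBranch t x d ∧ Sim c d) ∧ Sim r t := Iff.rfl

/-- Frees simulation from the order in which the root branches are listed. -/
theorem sim_iff {t s : LabelledTree X} :
    Sim t s ↔ ∀ x c, HasBranch t x c → ∃ d, HasBranch s x d ∧ Sim c d := by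
  induction t with
  | leaf => simp
  | cons y c r _ ih =>
    rw [cons_sim, ih]
    refine ⟨?_, fun h => ⟨h y c (.inl ⟨rfl, rfl⟩), fun x d hd => h x d (.inr hd)⟩⟩
    rintro ⟨h, h'⟩ x d (⟨rfl, rfl⟩ | hd)
    exacts [h, h' x d hd]

theorem Sim.mono {t s s' : LabelledTree X} (h : Sim t s)
    (hs : ∀ x c, HasBranch s x c → HasBranch s' x c) : Sim t s' := by
  rw [sim_iff] at h ⊢
  intro x c hc
  obtain ⟨d, hd, hcd⟩ := h x c hc
  exact ⟨d, hs x d hd, hcd⟩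

theorem Sim.refl (t : LabelledTree X) : Sim t t := by
  induction t with
  | leaf => trivial
  | cons x c r hc hr => exact ⟨⟨c, .inl ⟨rfl, rfl⟩, hc⟩, hr.mono fun _ _ => .inr⟩

theorem Sim.trans {t s r : LabelledTree X} (h : Sim t s) (h' : Sim s r) : Sim t r := by
  induction t generalizing s r with
  | leaf => trivial
  | cons x c q ihc ihq =>
    obtain ⟨⟨d, hd, hcd⟩, hq⟩ := h
    obtain ⟨d', hd', hdd'⟩ := sim_iff.1 h' x d hd
    exact ⟨⟨d', hd', ihc hcd hdd'⟩, ihq hq h'⟩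

theorem sim_append_left (t s : LabelledTree X) : Sim t (t ++ s) :=
  (Sim.refl t).mono fun _ _ h => hasBranch_append.2 (.inl h)

theorem sim_append_right (t s : LabelledTree X) : Sim s (t ++ s) :=
  (Sim.refl s).mono fun _ _ h => hasBranch_append.2 (.inr h)

theorem append_sim {t s r : LabelledTree X} : Sim (t ++ s) r ↔ Sim t r ∧ Sim s r := by
  induction t with
  | leaf => simp
  | cons x c q _ ih => rw [cons_append, cons_sim, cons_sim, ih, and_assoc]

theorem Sim.append {t t' s s' : LabelledTree X} (h : Sim t t') (h' : Sim s s') :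
    Sim (t ++ s) (t' ++ s') :=
  append_sim.2 ⟨h.trans (sim_append_left _ _), h'.trans (sim_append_right _ _)⟩

theorem append_comm_sim (t s : LabelledTree X) : Sim (t ++ s) (s ++ t) :=
  append_sim.2 ⟨sim_append_right _ _, sim_append_left _ _⟩

/-- The tree with a single branch at the root. -/
def branch (x : X) (c : LabelledTree X) : LabelledTree X := cons x c leaf

theorem branch_sim_branch {x y : X} {c d : LabelledTree X} :
    Sim (branch x c) (branch y d) ↔ x = y ∧ Sim c d := by
  simp only [branch, cons_sim, hasBranch_cons, not_hasBranch_leaf, or_false, leaf_sim, and_true]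
  exact ⟨fun ⟨_, ⟨h, h'⟩, hs⟩ => ⟨h, h' ▸ hs⟩, fun ⟨h, hs⟩ => ⟨d, ⟨h, rfl⟩, hs⟩⟩

end LabelledTree

/-! ### Trees with a trunk -/

/-- Rooted trees with a distinguished path (the trunk) starting at the root, given by the side
trees at the successive vertices of the trunk and the labels of its edges. -/
inductive TrunkTree (X : Type*) where
  | tip : LabelledTree X → TrunkTree X
  | step : LabelledTree X → X → TrunkTree X → TrunkTree X

namespace TrunkTree

open LabelledTree

variable {X : Type*}

/-- The underlying rooted tree. -/
def toRooted : TrunkTree X → LabelledTree X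
  | tip t => t
  | step t x m => t ++ branch x (toRooted m)

/-- The number of edges of the trunk. -/
def length : TrunkTree X → ℕ
  | tip _ => 0
  | step _ _ m => length m + 1

/-- Adding branches at the root. -/
def graft (t : LabelledTree X) : TrunkTree X → TrunkTree X
  | tip s => tip (t ++ s)
  | step s x m => step (t ++ s) x m

/-- Gluing the root of the second tree to the end of the trunk of the first. -/
def glue : TrunkTree X → TrunkTree X → TrunkTree X
  | tip t, n => graft t n
  | step t x m, n => step t x (glue m n)

theorem graft_graft (t s : LabelledTree X) (m : TrunkTree X) :
    graft t (graft s m) = graft (t ++ s) m := by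
  cases m <;> simp [graft, append_assoc]

theorem graft_leaf (m : TrunkTree X) : graft leaf m = m := by
  cases m <;> rfl

theorem graft_glue (t : LabelledTree X) (m n : TrunkTree X) :
    glue (graft t m) n = graft t (glue m n) := by
  cases m with
  | tip s => exact (graft_graft t s n).symm
  | step s x m => rfl

/-- Under these operations trees with a trunk form a unary monoid. -/
instance : UnaryMonoid (TrunkTree X) where
  mul := glue
  one := tip leaf
  plus m := tip (toRooted m)
  mul_assoc m n p := by
    change glue (glue m n) p = glue m (glue n p)
    induction m with
    | tip t => exact graft_glue t n p
    | step t x m ih => simp only [glue, ih]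
  one_mul m := graft_leaf m
  mul_one m := by
    change glue m (tip leaf) = m
    induction m with
    | tip t => simp [glue, graft]
    | step t x m ih => simp only [glue, ih]

theorem one_def : (1 : TrunkTree X) = tip leaf := rfl

theorem plus_def (m : TrunkTree X) : UnaryMonoid.plus m = tip (toRooted m) := rfl

@[simp] theorem tip_mul_tip (t s : LabelledTree X) : tip t * tip s = tip (t ++ s) := rfl

@[simp] theorem tip_mul_step (t s : LabelledTree X) (x : X) (m : TrunkTree X) :
    tip t * step s x m = step (t ++ s) x m := rfl

@[simp] theorem step_mul (t : LabelledTree X) (x : X) (m n : TrunkTree X) :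
    step t x m * n = step t x (m * n) := rfl

@[simp] theorem toRooted_tip (t : LabelledTree X) : toRooted (tip t) = t := rfl

@[simp] theorem toRooted_step (t : LabelledTree X) (x : X) (m : TrunkTree X) :
    toRooted (step t x m) = t ++ branch x (toRooted m) := rfl

theorem toRooted_tip_mul (t : LabelledTree X) (m : TrunkTree X) :
    toRooted (tip t * m) = t ++ toRooted m := by
  cases m <;> simp [append_assoc]

/-- Gluing `n` or its plus produces the same tree; only the end of the trunk differs. This is what
makes the law for `(xy)⁺` hold exactly. -/
theorem toRooted_mul_tip_toRooted (m n : TrunkTree X) :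
    toRooted (m * tip (toRooted n)) = toRooted (m * n) := by
  induction m with
  | tip t => simp [toRooted_tip_mul]
  | step t x m ih => simp [ih]

theorem length_mul (m n : TrunkTree X) : length (m * n) = length m + length n := by
  induction m with
  | tip t => cases n <;> simp [length]
  | step t x m ih =>
    simp only [step_mul, length, ih]
    omega

theorem toRooted_sim_toRooted_mul (m n : TrunkTree X) : Sim (toRooted m) (toRooted (m * n)) := by
  induction m with
  | tip t => rw [toRooted_tip_mul]; exact sim_append_left _ _
  | step t x m ih => exact (Sim.refl t).append (branch_sim_branch.2 ⟨rfl, ih⟩)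

/-- The existence of a morphism of labelled trees that maps the trunk onto the trunk. -/
def Le : TrunkTree X → TrunkTree X → Prop
  | tip t, tip s => Sim t s
  -- Side branches may be folded onto the trunk of the target, so `t` is compared with the whole
  -- tree above this vertex and not just with `s`.
  | step t x m, step s y n => x = y ∧ Le m n ∧ Sim t (toRooted (step s y n))
  | _, _ => False

@[simp] theorem tip_le_tip {t s : LabelledTree X} : Le (tip t) (tip s) ↔ Sim t s := by
  simp [Le]

@[simp] theorem step_le_step {t s : LabelledTree X} {x y : X} {m n : TrunkTree X} :
    Le (step t x m) (step s y n) ↔ x = y ∧ Le m n ∧ Sim t (toRooted (step s y n)) := by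
  simp [Le]

@[simp] theorem not_tip_le_step {t s : LabelledTree X} {x : X} {m : TrunkTree X} :
    ¬ Le (tip t) (step s x m) := by
  simp [Le]

@[simp] theorem not_step_le_tip {t s : LabelledTree X} {x : X} {m : TrunkTree X} :
    ¬ Le (step s x m) (tip t) := by
  simp [Le]

theorem Le.toRooted {m n : TrunkTree X} (h : Le m n) : Sim m.toRooted n.toRooted := by
  induction m generalizing n with
  | tip t =>
    cases n with
    | tip s => simpa using h
    | step s y n => simp at h
  | step t x m ih =>
    cases n with
    | tip s => simp at h
    | step s y n =>
      obtain ⟨rfl, h, ht⟩ := step_le_step.1 h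
      exact append_sim.2 ⟨ht, (branch_sim_branch.2 ⟨rfl, ih h⟩).trans (sim_append_right _ _)⟩

/-- Trunk length is the invariant that excludes the mismatched cases in the two quasi-identities. -/
theorem Le.length_eq {m n : TrunkTree X} (h : Le m n) : length m = length n := by
  induction m generalizing n with
  | tip t => cases n with
    | tip s => rfl
    | step s y n => simp at h
  | step t x m ih => cases n with
    | tip s => simp at h
    | step s y n => rw [length, length, ih (step_le_step.1 h).2.1]

theorem Le.refl (m : TrunkTree X) : Le m m := by
  induction m with
  | tip t => exact tip_le_tip.2 (Sim.refl t)
  | step t x m ih => exact step_le_step.2 ⟨rfl, ih, sim_append_left _ _⟩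

theorem Le.trans {m n p : TrunkTree X} (h : Le m n) (h' : Le n p) : Le m p := by
  induction m generalizing n p with
  | tip t =>
    cases n with
    | tip s => cases p with
      | tip r => exact tip_le_tip.2 ((tip_le_tip.1 h).trans (tip_le_tip.1 h'))
      | step r z p => simp at h'
    | step s y n => simp at h
  | step t x m ih =>
    cases n with
    | tip s => simp at h
    | step s y n => cases p with
      | tip r => simp at h'
      | step r z p =>
        obtain ⟨rfl, h₁, ht⟩ := step_le_step.1 h
        obtain ⟨rfl, h₂, _⟩ := step_le_step.1 h'
        exact step_le_step.2 ⟨rfl, ih h₁ h₂, ht.trans h'.toRooted⟩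

theorem Le.mul {m m' n n' : TrunkTree X} (h : Le m m') (h' : Le n n') :
    Le (m * n) (m' * n') := by
  induction m generalizing m' with
  | tip t =>
    cases m' with
    | step s y m' => simp at h
    | tip s =>
      have hts := tip_le_tip.1 h
      cases n with
      | tip r => cases n' with
        | tip r' => exact tip_le_tip.2 (hts.append (tip_le_tip.1 h'))
        | step r' y n' => simp at h'
      | step r x n => cases n' with
        | tip r' => simp at h'
        | step r' y n' =>
          obtain ⟨rfl, hn, hr⟩ := step_le_step.1 h'
          refine step_le_step.2 ⟨rfl, hn, ?_⟩
          rw [toRooted_step, append_assoc]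
          exact hts.append hr
  | step t x m ih =>
    cases m' with
    | tip s => simp at h
    | step s y m' =>
      obtain ⟨rfl, hm, ht⟩ := step_le_step.1 h
      exact step_le_step.2 ⟨rfl, ih hm, ht.trans (toRooted_sim_toRooted_mul (step s x m') n')⟩

/-- Additivity of length forces `m` and `n` to have equally long trunks, so the given morphism sends
the end of one to the end of the other. Since passing to the plus of `p` leaves the rooted trees
unchanged, the same morphism works with the shortened trunks. -/
theorem Le.mul_plus {m n p : TrunkTree X} (h : Le (m * p) (n * p)) :
    Le (m * UnaryMonoid.plus p) (n * UnaryMonoid.plus p) := by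
  rw [plus_def]
  induction m generalizing n with
  | tip t =>
    cases n with
    | tip s => simpa [toRooted_tip_mul] using h.toRooted
    | step s y n =>
      have := h.length_eq
      simp only [length_mul, length] at this
      omega
  | step t x m ih =>
    cases n with
    | tip s =>
      have := h.length_eq
      simp only [length_mul, length] at this
      omega
    | step s y n =>
      obtain ⟨rfl, hm, ht⟩ := step_le_step.1 h
      refine step_le_step.2 ⟨rfl, ih hm, ?_⟩
      change Sim t (s ++ branch x (n * tip p.toRooted).toRooted)
      rwa [toRooted_mul_tip_toRooted]

/-- The extra copy of `m` glued at the root folds back onto `m`. -/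
theorem plus_mul_self_le (m : TrunkTree X) : Le (UnaryMonoid.plus m * m) m := by
  cases m with
  | tip t => exact tip_le_tip.2 (append_sim.2 ⟨Sim.refl t, Sim.refl t⟩)
  | step t x m =>
    exact step_le_step.2 ⟨rfl, Le.refl m, append_sim.2 ⟨Sim.refl _, sim_append_left _ _⟩⟩

theorem le_plus_mul_self (m : TrunkTree X) : Le m (UnaryMonoid.plus m * m) := by
  conv_lhs => rw [← one_mul m]
  exact Le.mul (tip_le_tip.2 (leaf_sim _)) (Le.refl m)

/-- Equality in the free left adequate monoid implies morphisms both ways between the trees. -/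
theorem le_of_leftAdequateRel {Y : Type*}
    (φ : UnaryMonoidHom (FreeUnaryMonoid Y) (TrunkTree X)) {u v : FreeUnaryMonoid Y}
    (h : FreeUnaryMonoid.LeftAdequateRel u v) : Le (φ u) (φ v) ∧ Le (φ v) (φ u) := by
  induction h with
  | refl x => exact ⟨Le.refl _, Le.refl _⟩
  | symm _ ih => exact ih.symm
  | trans _ _ ih ih' => exact ⟨ih.1.trans ih'.1, ih'.2.trans ih.2⟩
  | mul _ _ ih ih' =>
    rw [map_mul, map_mul]
    exact ⟨ih.1.mul ih'.1, ih.2.mul ih'.2⟩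
  | plus _ ih =>
    rw [UnaryMonoidHom.map_plus, UnaryMonoidHom.map_plus]
    exact ⟨tip_le_tip.2 ih.1.toRooted, tip_le_tip.2 ih.2.toRooted⟩
  | plus_mul_self x =>
    rw [map_mul, UnaryMonoidHom.map_plus]
    exact ⟨plus_mul_self_le _, le_plus_mul_self _⟩
  | plus_plus_mul_plus x y =>
    simp only [map_mul, UnaryMonoidHom.map_plus]
    exact ⟨Le.refl _, Le.refl _⟩
  | plus_mul_plus_comm x y =>
    simp only [map_mul, UnaryMonoidHom.map_plus]
    exact ⟨tip_le_tip.2 (append_comm_sim _ _), tip_le_tip.2 (append_comm_sim _ _)⟩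
  | plus_mul x y =>
    simp only [map_mul, UnaryMonoidHom.map_plus, plus_def, toRooted_mul_tip_toRooted]
    exact ⟨Le.refl _, Le.refl _⟩
  | @eq_plus_of_idem x _ ih =>
    rw [UnaryMonoidHom.map_plus]
    rw [map_mul] at ih
    generalize φ x = m at ih ⊢
    -- A tree with empty trunk is fixed by plus; a nonempty trunk would have its length doubled by
    -- squaring, contrary to `ih`.
    cases m with
    | tip t => exact ⟨Le.refl _, Le.refl _⟩
    | step t x m =>
      have := ih.1.length_eq
      simp only [length_mul, length] at this
      omega
  | mul_plus_of_mul_eq _ ih =>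
    rw [map_mul, map_mul, UnaryMonoidHom.map_plus]
    rw [map_mul, map_mul] at ih
    exact ⟨ih.1.mul_plus, ih.2.mul_plus⟩

end TrunkTree

/-! ### Values of trees in left adequate monoids -/

namespace IsLeftAdequate

variable {M : Type*} [UnaryMonoid M] [IsLeftAdequate M]

theorem plus_one : UnaryMonoid.plus (1 : M) = 1 :=
  (eq_plus_of_idem 1 (one_mul 1)).symm

theorem plus_mul_of_plus_eq {e : M} (he : UnaryMonoid.plus e = e) (x : M) :
    UnaryMonoid.plus (e * x) = e * UnaryMonoid.plus x := by
  have := plus_plus_mul_plus e x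
  rw [he] at this
  rw [plus_mul, this]

theorem mul_comm_of_plus_eq {e f : M} (he : UnaryMonoid.plus e = e)
    (hf : UnaryMonoid.plus f = f) : e * f = f * e := by
  have := plus_mul_plus_comm e f
  rwa [he, hf] at this

theorem mul_self_of_plus_eq {e : M} (he : UnaryMonoid.plus e = e) : e * e = e := by
  have := plus_mul_self e
  rwa [he] at this

end IsLeftAdequate

namespace LabelledTree

open IsLeftAdequate

variable {X M : Type*} [UnaryMonoid M]

/-- The idempotent represented by a rooted tree. -/
def val (f : X → M) : LabelledTree X → M
  | leaf => 1
  | cons x c r => UnaryMonoid.plus (f x * val f c) * val f r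

theorem val_append (f : X → M) (t s : LabelledTree X) : val f (t ++ s) = val f t * val f s := by
  induction t with
  | leaf => simp [val]
  | cons x c r _ ih => simp [val, ih, mul_assoc]

theorem val_branch (f : X → M) (x : X) (c : LabelledTree X) :
    val f (branch x c) = UnaryMonoid.plus (f x * val f c) := by
  simp [branch, val]

variable [IsLeftAdequate M]

theorem plus_plus (x : M) : UnaryMonoid.plus (UnaryMonoid.plus x) = UnaryMonoid.plus x := by
  simpa [plus_one] using plus_plus_mul_plus x 1

theorem plus_val (f : X → M) (t : LabelledTree X) : UnaryMonoid.plus (val f t) = val f t := by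
  induction t with
  | leaf => exact plus_one
  | cons x c r _ ih =>
    rw [val, plus_mul_of_plus_eq (plus_plus _), ih]

/-- The factors of the value of `t` are commuting idempotents, so a repeated one is absorbed. -/
theorem val_mul_of_hasBranch (f : X → M) {t c : LabelledTree X} {x : X} (h : HasBranch t x c) :
    UnaryMonoid.plus (f x * val f c) * val f t = val f t := by
  induction t with
  | leaf => exact h.elim
  | cons y d r _ ih =>
    rw [val]
    rcases h with ⟨rfl, rfl⟩ | h
    · rw [← mul_assoc, mul_self_of_plus_eq (plus_plus _)]
    · rw [← mul_assoc, plus_mul_plus_comm, mul_assoc, ih h]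

/-- In the semilattice of plus-fixed elements this says that the value of `s` lies below that of
`t`: a morphism realises each condition imposed by `t` inside `s`. -/
theorem Sim.val_mul_val (f : X → M) {t s : LabelledTree X} (h : Sim t s) :
    val f t * val f s = val f s := by
  induction t generalizing s with
  | leaf => exact one_mul _
  | cons x c r ihc ihr =>
    obtain ⟨⟨d, hd, hcd⟩, hr⟩ := h
    -- By induction the value of `c` can be inserted before that of `d`, which exposes `f x * val f
    -- c` to its own plus.
    have hle : UnaryMonoid.plus (f x * val f c) * (f x * val f d) = f x * val f d := by
      rw [← ihc hcd, ← mul_assoc (f x), ← mul_assoc, plus_mul_self]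
    have hle' : UnaryMonoid.plus (f x * val f c) * UnaryMonoid.plus (f x * val f d) =
        UnaryMonoid.plus (f x * val f d) := by
      rw [← plus_mul_of_plus_eq (plus_plus _), hle]
    rw [val, mul_assoc, ihr hr]
    conv_lhs => rw [← val_mul_of_hasBranch f hd, ← mul_assoc, hle']
    exact val_mul_of_hasBranch f hd

end LabelledTree

namespace TrunkTree

open IsLeftAdequate LabelledTree

variable {X M : Type*} [UnaryMonoid M]

/-- The element represented by a tree with a trunk. -/
def val (f : X → M) : TrunkTree X → M
  | tip t => t.val f
  | step t x m => t.val f * (f x * val f m)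

/-- The tree with a trunk of a single edge. -/
def letter (x : X) : TrunkTree X := step leaf x 1

theorem val_mul (f : X → M) (m n : TrunkTree X) : val f (m * n) = val f m * val f n := by
  induction m with
  | tip t => cases n <;> simp [val, val_append, mul_assoc]
  | step t x m ih => simp [val, ih, mul_assoc]

theorem val_letter (f : X → M) (x : X) : val f (letter x) = f x := by
  simp [letter, val, LabelledTree.val, one_def]

variable [IsLeftAdequate M]

theorem val_toRooted (f : X → M) (m : TrunkTree X) :
    m.toRooted.val f = UnaryMonoid.plus (val f m) := by
  induction m with
  | tip t => exact (plus_val f t).symm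
  | step t x m ih =>
    rw [toRooted_step, val_append, val_branch, ih, ← IsLeftAdequate.plus_mul, val,
      plus_mul_of_plus_eq (plus_val f t)]

/-- Evaluation of trees with a trunk, as a morphism. -/
def valHom (f : X → M) : UnaryMonoidHom (TrunkTree X) M where
  toFun := val f
  map_one' := rfl
  map_mul' := val_mul f
  map_plus' m := val_toRooted f m

/-- Trees with morphisms both ways have the same value in every left adequate monoid. -/
theorem val_eq_of_le (f : X → M) {m n : TrunkTree X} (h : Le m n) (h' : Le n m) :
    val f m = val f n := by
  induction m generalizing n with
  | tip t =>
    cases n with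
    | tip s =>
      -- Antisymmetry of the semilattice order.
      simp only [val]
      rw [← (tip_le_tip.1 h).val_mul_val f, mul_comm_of_plus_eq (plus_val f t) (plus_val f s),
        (tip_le_tip.1 h').val_mul_val f]
    | step s y n => simp at h
  | step t x m ih =>
    cases n with
    | tip s => simp at h
    | step s y n =>
      obtain ⟨rfl, h₁, ht⟩ := step_le_step.1 h
      obtain ⟨-, h₂, hs⟩ := step_le_step.1 h'
      -- The value of `t` absorbs into the plus of the whole element, and that plus absorbs into the
      -- element itself.
      have key : ∀ {t s : LabelledTree X} {m : TrunkTree X}, Sim t (toRooted (step s x m)) →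
          t.val f * (s.val f * (f x * val f m)) = s.val f * (f x * val f m) := by
        intro t s m hs
        have := hs.val_mul_val f
        rw [val_toRooted] at this
        have := congrArg (· * val f (step s x m)) this
        simpa only [mul_assoc, plus_mul_self, val] using this
      have ht' := key ht
      have hs' := key hs
      simp only [val]
      rw [ih h₁ h₂] at hs' ⊢
      rw [← hs', ← mul_assoc, mul_comm_of_plus_eq (plus_val f s) (plus_val f t), mul_assoc, ht']

end TrunkTree

/-! ### The solution of the word problem -/

namespace FreeUnaryMonoid

open TrunkTree

/-- The tree represented by a word. -/
def tree {X : Type*} : UnaryMonoidHom (FreeUnaryMonoid X) (TrunkTree X) := lift letter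

theorem val_tree {X : Type*} (u : FreeUnaryMonoid X) :
    (tree u).val FLAd.of = FLAd.proj X u := by
  have : (valHom FLAd.of).comp tree = FLAd.proj X := hom_ext fun x => val_letter FLAd.of x
  exact DFunLike.congr_fun this u

theorem proj_eq_of_tree_le {X : Type*} {u v : FreeUnaryMonoid X} (h : Le (tree u) (tree v))
    (h' : Le (tree v) (tree u)) : FLAd.proj X u = FLAd.proj X v := by
  rw [← val_tree, ← val_tree, val_eq_of_le _ h h']

end FreeUnaryMonoid

/-! ### Encoding in two letters -/

namespace LabelledTree

open TwoLetters

/-- Prepending a path labelled `aⁱb`. -/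
def chain : ℕ → LabelledTree TwoLetters → LabelledTree TwoLetters
  | 0, t => branch b t
  | i + 1, t => branch a (chain i t)

/-- Replacing every edge labelled `x` by a path labelled `b aⁱ b` with `i = idx x`. -/
def enc {X : Type*} (idx : X → ℕ) : LabelledTree X → LabelledTree TwoLetters
  | leaf => leaf
  | cons x c r => cons b (chain (idx x) (enc idx c)) (enc idx r)

variable {X : Type*} {idx : X → ℕ}

theorem enc_append (t s : LabelledTree X) : enc idx (t ++ s) = enc idx t ++ enc idx s := by
  induction t with
  | leaf => rfl
  | cons x c r _ ih => simp [enc, ih]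

theorem enc_branch (x : X) (c : LabelledTree X) :
    enc idx (branch x c) = branch b (chain (idx x) (enc idx c)) := rfl

/-- Before its final `b`, a chain has only one edge at each vertex, so the morphism is forced, and
the first `b` reveals the exponent. -/
theorem chain_sim_chain {i j : ℕ} {c d : LabelledTree TwoLetters}
    (h : Sim (chain i c) (chain j d)) :
    i = j ∧ Sim c d := by
  induction i generalizing j with
  | zero =>
    cases j with
    | zero => exact ⟨rfl, (branch_sim_branch.1 h).2⟩
    | succ j => exact absurd (branch_sim_branch.1 h).1 (by simp)
  | succ i ih =>
    cases j with
    | zero => exact absurd (branch_sim_branch.1 h).1 (by simp)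
    | succ j =>
      obtain ⟨rfl, hcd⟩ := ih (branch_sim_branch.1 h).2
      exact ⟨rfl, hcd⟩

theorem exists_of_hasBranch_enc {t : LabelledTree X} {y : TwoLetters} {d : LabelledTree TwoLetters}
    (h : HasBranch (enc idx t) y d) : ∃ x c, HasBranch t x c ∧ d = chain (idx x) (enc idx c) := by
  induction t with
  | leaf => exact h.elim
  | cons x c r _ ih =>
    rcases h with ⟨-, rfl⟩ | h
    · exact ⟨x, c, .inl ⟨rfl, rfl⟩, rfl⟩
    · obtain ⟨x', c', hc', rfl⟩ := ih h
      exact ⟨x', c', .inr hc', rfl⟩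

/-- Each edge leaving an original vertex begins a complete code path, so a morphism carries code
paths to code paths; injectivity of `idx` recovers the labels. -/
theorem sim_of_enc_sim (hidx : Function.Injective idx) {t s : LabelledTree X}
    (h : Sim (enc idx t) (enc idx s)) : Sim t s := by
  induction t generalizing s with
  | leaf => trivial
  | cons x c r ihc ihr =>
    obtain ⟨⟨d, hd, hcd⟩, hr⟩ := h
    obtain ⟨y, c', hc', rfl⟩ := exists_of_hasBranch_enc hd
    obtain ⟨hxy, hcc'⟩ := chain_sim_chain hcd
    obtain rfl := hidx hxy
    exact ⟨⟨c', hc', ihc hcc'⟩, ihr hr⟩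

end LabelledTree

namespace TrunkTree

open TwoLetters LabelledTree

/-- Prolonging the trunk at its start by a path labelled `aⁱb`. -/
def chain : ℕ → TrunkTree TwoLetters → TrunkTree TwoLetters
  | 0, m => step leaf b m
  | i + 1, m => step leaf a (chain i m)

/-- Replacing every edge labelled `x` by a path labelled `b aⁱ b` with `i = idx x`. -/
def enc {X : Type*} (idx : X → ℕ) : TrunkTree X → TrunkTree TwoLetters
  | tip t => tip (t.enc idx)
  | step t x m => step (t.enc idx) b (chain (idx x) (enc idx m))

variable {X : Type*} {idx : X → ℕ}

theorem chain_mul (i : ℕ) (m n : TrunkTree TwoLetters) : chain i m * n = chain i (m * n) := by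
  induction i with
  | zero => rfl
  | succ i ih => simp only [chain, step_mul, ih]

theorem toRooted_chain (i : ℕ) (m : TrunkTree TwoLetters) :
    toRooted (chain i m) = LabelledTree.chain i (toRooted m) := by
  induction i with
  | zero => rfl
  | succ i ih => simp only [chain, LabelledTree.chain, toRooted_step, ih, leaf_append]

theorem enc_mul (m n : TrunkTree X) : enc idx (m * n) = enc idx m * enc idx n := by
  induction m with
  | tip t => cases n <;> simp [enc, enc_append]
  | step t x m ih => simp [enc, ih, chain_mul]

theorem toRooted_enc (m : TrunkTree X) : toRooted (enc idx m) = (toRooted m).enc idx := by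
  induction m with
  | tip t => rfl
  | step t x m ih => simp [enc, toRooted_chain, ih, enc_append, enc_branch]

/-- The encoding, as a morphism. -/
def encHom (idx : X → ℕ) : UnaryMonoidHom (TrunkTree X) (TrunkTree TwoLetters) where
  toFun := enc idx
  map_one' := rfl
  map_mul' := enc_mul
  map_plus' m := by simp only [plus_def, enc, toRooted_enc]

theorem letter_mul (y : TwoLetters) (m : TrunkTree TwoLetters) : letter y * m = step leaf y m := by
  rw [letter, step_mul, one_mul]

theorem pow_mul_letter_mul (i : ℕ) (m : TrunkTree TwoLetters) :
    letter a ^ i * (letter b * m) = chain i m := by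
  induction i with
  | zero => rw [pow_zero, one_mul, letter_mul, chain]
  | succ i ih => rw [pow_succ', mul_assoc, ih, letter_mul, chain]

theorem enc_letter (x : X) : enc idx (letter x) = letter b * letter a ^ idx x * letter b := by
  rw [mul_assoc, ← mul_one (letter a ^ idx x * letter b), mul_assoc, pow_mul_letter_mul, letter_mul]
  rfl

theorem le_of_chain_le_chain {i j : ℕ} {m n : TrunkTree TwoLetters}
    (h : Le (chain i m) (chain j n)) :
    i = j ∧ Le m n := by
  induction i generalizing j with
  | zero =>
    cases j with
    | zero => exact ⟨rfl, (step_le_step.1 h).2.1⟩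
    | succ j => exact absurd (step_le_step.1 h).1 (by simp)
  | succ i ih =>
    cases j with
    | zero => exact absurd (step_le_step.1 h).1 (by simp)
    | succ j =>
      obtain ⟨rfl, hmn⟩ := ih (step_le_step.1 h).2.1
      exact ⟨rfl, hmn⟩

theorem le_of_enc_le (hidx : Function.Injective idx) {m n : TrunkTree X}
    (h : Le (enc idx m) (enc idx n)) : Le m n := by
  induction m generalizing n with
  | tip t =>
    cases n with
    | tip s => exact tip_le_tip.2 (sim_of_enc_sim hidx (tip_le_tip.1 h))
    | step s y n => simp [enc] at h
  | step t x m ih =>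
    cases n with
    | tip s => simp [enc] at h
    | step s y n =>
      obtain ⟨-, hchain, ht⟩ := step_le_step.1 h
      obtain ⟨hxy, hmn⟩ := le_of_chain_le_chain hchain
      obtain rfl := hidx hxy
      refine step_le_step.2 ⟨rfl, ih hmn, sim_of_enc_sim hidx ?_⟩
      rw [← toRooted_enc]
      exact ht

end TrunkTree

namespace FLAd

open TwoLetters TrunkTree

/-- The morphism that maps `x` to `b aⁱ b` with `i = idx x`. -/
noncomputable def encode {X : Type*} (idx : X → ℕ) : UnaryMonoidHom (FLAd X) (FLAd TwoLetters) :=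
  lift fun x => of b * of a ^ idx x * of b

/-- Lifted to words, the map is the substitution `F`, and on trees `F` is the edge replacement
`encHom`. Equality of images thus becomes mutual `Le` of encoded trees, which decodes. -/
theorem encode_injective {X : Type*} {idx : X → ℕ} (hidx : Function.Injective idx) :
    Function.Injective (encode idx) := by
  let F : UnaryMonoidHom (FreeUnaryMonoid X) (FreeUnaryMonoid TwoLetters) :=
    FreeUnaryMonoid.lift fun x =>
      FreeUnaryMonoid.of b * FreeUnaryMonoid.of a ^ idx x * FreeUnaryMonoid.of b
  have hF : (encode idx).comp (proj X) = (proj TwoLetters).comp F :=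
    FreeUnaryMonoid.hom_ext fun x => by simp [encode, F]
  have hF' : (encHom idx).comp FreeUnaryMonoid.tree = FreeUnaryMonoid.tree.comp F := by
    refine FreeUnaryMonoid.hom_ext fun x => ?_
    simp only [UnaryMonoidHom.comp_apply, FreeUnaryMonoid.tree, F, FreeUnaryMonoid.lift_of,
      map_mul, map_pow]
    exact enc_letter x
  intro m n h
  obtain ⟨u, rfl⟩ := proj_surjective X m
  obtain ⟨v, rfl⟩ := proj_surjective X n
  have hu := DFunLike.congr_fun hF u
  have hv := DFunLike.congr_fun hF v
  simp only [UnaryMonoidHom.comp_apply] at hu hv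
  rw [hu, hv] at h
  have hle := le_of_leftAdequateRel FreeUnaryMonoid.tree (proj_eq_proj_iff.1 h)
  have hu' := DFunLike.congr_fun hF' u
  have hv' := DFunLike.congr_fun hF' v
  simp only [UnaryMonoidHom.comp_apply] at hu' hv'
  rw [← hu', ← hv'] at hle
  exact FreeUnaryMonoid.proj_eq_of_tree_le (le_of_enc_le hidx hle.1) (le_of_enc_le hidx hle.2)

theorem exists_twoLetters_embedding (X : Type*) [Nontrivial X] :
    ∃ ψ : UnaryMonoidHom (FLAd TwoLetters) (FLAd X), Function.Injective ψ := by
  classical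
  obtain ⟨x, y, hxy⟩ := exists_pair_ne X
  let f : TwoLetters → X := fun c => TwoLetters.casesOn c x y
  let g : X → TwoLetters := fun z => if z = x then a else b
  have hgf : Function.LeftInverse g f := by
    rintro (_ | _)
    · exact if_pos rfl
    · exact if_neg hxy.symm
  exact ⟨_, lift_of_comp_injective hgf⟩

theorem satisfiesIdentity_iff {X : Type*} [Nontrivial X] {S : Type*} (u v : FreeUnaryMonoid S) :
    SatisfiesIdentity (FLAd X) u v ↔ proj S u = proj S v := by
  classical
  refine ⟨fun h => ?_, fun h φ => hom_eq_of_proj_eq φ h⟩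
  obtain ⟨F, hF⟩ := FreeUnaryMonoid.exists_finset_forall_mem_range u
  obtain ⟨F', hF'⟩ := FreeUnaryMonoid.exists_finset_forall_mem_range v
  -- Both words are pulled back to one common finite alphabet.
  obtain ⟨u₀, rfl⟩ := hF (F ∪ F') Finset.subset_union_left
  obtain ⟨v₀, rfl⟩ := hF' (F ∪ F') Finset.subset_union_right
  obtain ⟨idx, hidx⟩ := Countable.exists_injective_nat (F ∪ F' : Finset S)
  obtain ⟨ψ, hψ⟩ := exists_twoLetters_embedding X
  -- Letters outside the finite alphabet occur in neither word, so the value `1` is arbitrary.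
  let g : S → FLAd X := fun s => if hs : s ∈ F ∪ F' then ψ (encode idx (of ⟨s, hs⟩)) else 1
  have hg : (FreeUnaryMonoid.lift g).comp
      (FreeUnaryMonoid.lift fun s : (F ∪ F' : Finset S) => FreeUnaryMonoid.of (s : S)) =
      (ψ.comp (encode idx)).comp (proj _) := by
    refine FreeUnaryMonoid.hom_ext fun s => ?_
    simp only [UnaryMonoidHom.comp_apply, FreeUnaryMonoid.lift_of, proj_of]
    exact dif_pos s.2
  have hu := DFunLike.congr_fun hg u₀
  have hv := DFunLike.congr_fun hg v₀
  simp only [UnaryMonoidHom.comp_apply] at hu hv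
  have huv := h (FreeUnaryMonoid.lift g)
  rw [hu, hv] at huv
  -- Injectivity gives equality over the finite alphabet, which the inclusion into `S` preserves.
  exact hom_eq_of_proj_eq ((proj S).comp (FreeUnaryMonoid.lift _)) (encode_injective hidx (hψ huv))

end FLAd

instance : Nontrivial TwoLetters := ⟨⟨.a, .b, by simp⟩⟩

theorem mainTheorem8 {X : Type*} [Nontrivial X] :
    -- for every indexing of `X` by distinct naturals, `x_i ↦ b aⁱ b` extends to an embedding
    (∀ idx : X → ℕ, Function.Injective idx →
      ∃ φ : UnaryMonoidHom (FLAd X) (FLAd TwoLetters),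
        (∀ x : X, φ (FLAd.of x) =
          FLAd.of TwoLetters.b * FLAd.of TwoLetters.a ^ idx x * FLAd.of TwoLetters.b) ∧
        Function.Injective φ) ∧
    -- hence `FLAd(X)` embeds in `FLAd({a,b})` when `X` is finite or countably infinite
    (Countable X →
      ∃ φ : UnaryMonoidHom (FLAd X) (FLAd TwoLetters), Function.Injective φ) ∧
    -- `FLAd(X)` and `FLAd({a,b})` satisfy the same identities, over any alphabet `S`
    (∀ (S : Type*) (u v : FreeUnaryMonoid S),
      SatisfiesIdentity (FLAd X) u v ↔ SatisfiesIdentity (FLAd TwoLetters) u v) ∧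
    -- and these are exactly the pairs that represent the same element of `FLAd(S)`
    (∀ (S : Type*) (u v : FreeUnaryMonoid S),
      SatisfiesIdentity (FLAd X) u v ↔ FLAd.proj S u = FLAd.proj S v) := by
  refine ⟨fun idx hidx => ⟨FLAd.encode idx, fun x => FLAd.lift_of _ x, FLAd.encode_injective hidx⟩,
    fun _ => ?_, fun S u v => ?_, fun S u v => FLAd.satisfiesIdentity_iff u v⟩
  · obtain ⟨idx, hidx⟩ := Countable.exists_injective_nat X
    exact ⟨FLAd.encode idx, FLAd.encode_injective hidx⟩
  · rw [FLAd.satisfiesIdentity_iff, FLAd.satisfiesIdentity_iff]
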